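/- All rings are associative and unital, and all ring homomorphisms are unital. A \emph{ring extension} $A \supseteq B$ is a ring homomorphism $B \to A$ (for instance the inclusion of a subring), along which $A$-modules and bimodules are restricted to $B$. Write ${}_A\mathcal M$ and $\mathcal M_A$ for the categories of left and right $A$-modules. A \emph{Morita bimodule} ${}_AP_R$ is an invertible $A$-$R$-bimodule, that is, one for which there is an $R$-$A$-bimodule $P'$ with bimodule isomorphisms $P \otimes_R P' \cong {}_AA_A$ and $P' \otimes_A P \cong {}_RR_R$. For a bimodule ${}_AP_R$ let $P^* = \mathrm{Hom}(P_R, R_R)$, an $R$-$A$-bimodule by $(r\varphi a)(p) = r\,\varphi(ap)$. For an extension $A \supseteq B$ let $\mathrm{Res}^A_B : {}_A\mathcal M \to {}_B\mathcal M$ be restriction, $\mathrm{Ind}^A_B = A \otimes_B - : {}_B\mathcal M \to {}_A\mathcal M$ induction, and $\mathrm{Coind}^A_B = \mathrm{Hom}({}_BA, {}_B-) : {}_B\mathcal M \to {}_A\mathcal M$ coinduction, where $(a\varphi)(x) = \varphi(xa)$. \textbf{Proposition.} Let $A \supseteq B$ and $R \supseteq S$ be ring extensions. The following conditions are equivalent.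 \begin{enumerate} \item $A \supseteq B$ and $R \supseteq S$ are Morita equivalent: there are additive equivalences $\mathcal P : {}_R\mathcal M \to {}_A\mathcal M$ and $\mathcal Q : {}_S\mathcal M \to {}_B\mathcal M$ and a natural isomorphism $\mathcal Q\,\mathrm{Res}^R_S \cong \mathrm{Res}^A_B\,\mathcal P$. \item There are Morita bimodules ${}_AP_R$ and ${}_BQ_S$ with ${}_BQ \otimes_S R_R \cong {}_BP_R$ as $B$-$R$-bimodules. \item There are Morita bimodules ${}_AP_R$ and ${}_BQ_S$ with ${}_RR \otimes_S Q^*{}_B \cong {}_RP^*{}_B$ as $R$-$B$-bimodules. \item There are Morita bimodules ${}_AP_R$ and ${}_BQ_S$ with ${}_AA \otimes_B Q_S \cong {}_AP_S$ as $A$-$S$-bimodules. \item There are Morita bimodules ${}_AP_R$ and ${}_BQ_S$ with ${}_SQ^* \otimes_B A_A \cong {}_SP^*{}_A$ as $S$-$A$-bimodules. \item There are additive equivalences $\mathcal P : {}_R\mathcal M \to {}_A\mathcal M$ and $\mathcal Q : {}_S\mathcal M \to {}_B\mathcal M$ and a natural isomorphism $\mathcal P\,\mathrm{Ind}^R_S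 \cong \mathrm{Ind}^A_B\,\mathcal Q$. \item There are additive equivalences $\mathcal P : {}_R\mathcal M \to {}_A\mathcal M$ and $\mathcal Q : {}_S\mathcal M \to {}_B\mathcal M$ and a natural isomorphism $\mathcal P\,\mathrm{Coind}^R_S \cong \mathrm{Coind}^A_B\,\mathcal Q$. \item Any one of the conditions (1)--(7) with left and right interchanged throughout, that is, the same condition for right modules ($\mathcal M_R$, $\mathcal M_A$, $\mathcal M_S$, $\mathcal M_B$ in place of the left module categories); equivalently, the same condition for the opposite extensions $A^{\mathrm{op}} \supseteq B^{\mathrm{op}}$ and $R^{\mathrm{op}} \supseteq S^{\mathrm{op}}$. Each of these seven conditions is equivalent to each of (1)--(7). \end{enumerate} -/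

import Mathlib

open CategoryTheory MulOpposite
open scoped TensorProduct

universe u

namespace MoritaExt

/-! ### The tensor product `M ⊗_S N` over a (noncommutative) ring

Right `S`-modules are modules over `Sᵐᵒᵖ`, as everywhere in Mathlib: `op s • m` is `m s`. -/

section Balanced

/-- The subgroup of `M ⊗_ℤ N` generated by all `m s ⊗ n - m ⊗ s n`. -/
def balancedRel (S M N : Type*) [Ring S] [AddCommGroup M] [AddCommGroup N]
    [Module Sᵐᵒᵖ M] [Module S N] : AddSubgroup (M ⊗[ℤ] N) :=
  AddSubgroup.closure
    {x | ∃ (m : M) (s : S) (n : N), x = (op s • m) ⊗ₜ[ℤ] n - m ⊗ₜ[ℤ] (s • n)}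

/-- The tensor product `M ⊗_S N` of a right `S`-module `M` and a left `S`-module `N`. -/
def BalTensor (S M N : Type*) [Ring S] [AddCommGroup M] [AddCommGroup N]
    [Module Sᵐᵒᵖ M] [Module S N] : Type _ :=
  (M ⊗[ℤ] N) ⧸ balancedRel S M N

variable {S M N M' N' M'' N'' : Type*} [Ring S]
  [AddCommGroup M] [AddCommGroup N] [Module Sᵐᵒᵖ M] [Module S N]
  [AddCommGroup M'] [AddCommGroup N'] [Module Sᵐᵒᵖ M'] [Module S N']
  [AddCommGroup M''] [AddCommGroup N''] [Module Sᵐᵒᵖ M''] [Module S N'']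

noncomputable instance BalTensor.instAddCommGroup : AddCommGroup (BalTensor S M N) :=
  inferInstanceAs (AddCommGroup ((M ⊗[ℤ] N) ⧸ balancedRel S M N))

namespace BalTensor

/-- The canonical projection `M ⊗_ℤ N → M ⊗_S N`. -/
noncomputable def mk (S M N : Type*) [Ring S] [AddCommGroup M] [AddCommGroup N]
    [Module Sᵐᵒᵖ M] [Module S N] : (M ⊗[ℤ] N) →+ BalTensor S M N :=
  QuotientAddGroup.mk' (balancedRel S M N)

/-- The elementary tensor `m ⊗ n` in `M ⊗_S N`. -/
noncomputable def tmul (S : Type*) {M N : Type*} [Ring S] [AddCommGroup M] [AddCommGroup N]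
    [Module Sᵐᵒᵖ M] [Module S N] (m : M) (n : N) : BalTensor S M N :=
  mk S M N (m ⊗ₜ[ℤ] n)

theorem tmul_add (m : M) (n n' : N) : tmul S m (n + n') = tmul S m n + tmul S m n' := by
  unfold tmul
  rw [TensorProduct.tmul_add, map_add]

theorem add_tmul (m m' : M) (n : N) : tmul S (m + m') n = tmul S m n + tmul S m' n := by
  unfold tmul
  rw [TensorProduct.add_tmul, map_add]

theorem zero_tmul (n : N) : tmul S (0 : M) n = 0 := by
  unfold tmul
  rw [TensorProduct.zero_tmul, map_zero]

theorem tmul_zero (m : M) : tmul S m (0 : N) = 0 := by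
  unfold tmul
  rw [TensorProduct.tmul_zero, map_zero]

theorem smul_tmul (m : M) (s : S) (n : N) : tmul S (op s • m) n = tmul S m (s • n) := by
  unfold tmul
  rw [← sub_eq_zero, ← map_sub]
  exact (QuotientAddGroup.eq_zero_iff _).2 (AddSubgroup.subset_closure ⟨m, s, n, rfl⟩)

theorem induction_on {p : BalTensor S M N → Prop} (x : BalTensor S M N)
    (zero : p 0) (tmul : ∀ m n, p (tmul S m n))
    (add : ∀ x y, p x → p y → p (x + y)) : p x := by
  obtain ⟨x, rfl⟩ := QuotientAddGroup.mk'_surjective (balancedRel S M N) x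
  induction x using TensorProduct.induction_on with
  | zero => exact zero
  | tmul m n => exact tmul m n
  | add x y hx hy => exact add _ _ hx hy

theorem hom_ext {G : Type*} [AddCommGroup G] {φ ψ : BalTensor S M N →+ G}
    (h : ∀ m n, φ (tmul S m n) = ψ (tmul S m n)) : φ = ψ := by
  ext x
  induction x using induction_on with
  | zero => simp
  | tmul m n => exact h m n
  | add x y hx hy => rw [map_add, map_add, hx, hy]

/-- The map `f ⊗ g : M ⊗_S N → M' ⊗_S N'`. -/
noncomputable def map (f : M →ₗ[Sᵐᵒᵖ] M') (g : N →ₗ[S] N') :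
    BalTensor S M N →+ BalTensor S M' N' :=
  QuotientAddGroup.map (balancedRel S M N) (balancedRel S M' N')
    (TensorProduct.map f.toAddMonoidHom.toIntLinearMap
      g.toAddMonoidHom.toIntLinearMap).toAddMonoidHom
    (by
      refine (AddSubgroup.closure_le _).2 ?_
      rintro _ ⟨m, s, n, rfl⟩
      refine AddSubgroup.subset_closure ⟨f m, s, g n, ?_⟩
      simp)

@[simp]
theorem map_tmul (f : M →ₗ[Sᵐᵒᵖ] M') (g : N →ₗ[S] N') (m : M) (n : N) :
    map f g (tmul S m n) = tmul S (f m) (g n) := rfl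

theorem map_id_id : map (LinearMap.id : M →ₗ[Sᵐᵒᵖ] M) (LinearMap.id : N →ₗ[S] N) =
    AddMonoidHom.id _ :=
  hom_ext fun _ _ => rfl

theorem map_comp_comp (f : M →ₗ[Sᵐᵒᵖ] M') (f' : M' →ₗ[Sᵐᵒᵖ] M'')
    (g : N →ₗ[S] N') (g' : N' →ₗ[S] N'') :
    map (f' ∘ₗ f) (g' ∘ₗ g) = (map f' g').comp (map f g) :=
  hom_ext fun _ _ => rfl

/-- The left `A`-module structure `a (m ⊗ n) = (a m) ⊗ n` on `M ⊗_S N`, for an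
`A`-`S`-bimodule `M`. -/
@[reducible]
noncomputable def leftModule (A S M N : Type*) [Ring A] [Ring S] [AddCommGroup M]
    [AddCommGroup N] [Module A M] [Module Sᵐᵒᵖ M] [SMulCommClass A Sᵐᵒᵖ M] [Module S N] :
    Module A (BalTensor S M N) :=
  let φ : A → BalTensor S M N →+ BalTensor S M N := fun a =>
    map (Module.toModuleEnd Sᵐᵒᵖ (S := A) M a) LinearMap.id
  { smul := fun a x => φ a x
    one_smul := DFunLike.congr_fun (f := φ 1) (g := AddMonoidHom.id _)
      (hom_ext fun m n => congrArg (tmul S · n) (one_smul A m))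
    mul_smul := fun a b => DFunLike.congr_fun (f := φ (a * b)) (g := (φ a).comp (φ b))
      (hom_ext fun m n => congrArg (tmul S · n) (mul_smul a b m))
    smul_zero := fun a => map_zero (φ a)
    smul_add := fun a => map_add (φ a)
    add_smul := fun a b => DFunLike.congr_fun (f := φ (a + b)) (g := φ a + φ b)
      (hom_ext fun m n => (congrArg (tmul S · n) (add_smul a b m)).trans (add_tmul _ _ _))
    zero_smul := DFunLike.congr_fun (f := φ 0) (g := 0)
      (hom_ext fun m n => (congrArg (tmul S · n) (zero_smul A m)).trans (zero_tmul _)) }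

/-- The right `C`-module structure `(m ⊗ n) c = m ⊗ (n c)` on `M ⊗_S N`, for an
`S`-`C`-bimodule `N`. -/
@[reducible]
noncomputable def rightModule (S C M N : Type*) [Ring S] [Ring C] [AddCommGroup M]
    [AddCommGroup N] [Module Sᵐᵒᵖ M] [Module S N] [Module Cᵐᵒᵖ N] [SMulCommClass S Cᵐᵒᵖ N] :
    Module Cᵐᵒᵖ (BalTensor S M N) :=
  haveI : SMulCommClass Cᵐᵒᵖ S N := SMulCommClass.symm _ _ _
  let φ : Cᵐᵒᵖ → BalTensor S M N →+ BalTensor S M N := fun c =>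
    map LinearMap.id (Module.toModuleEnd S (S := Cᵐᵒᵖ) N c)
  { smul := fun c x => φ c x
    one_smul := DFunLike.congr_fun (f := φ 1) (g := AddMonoidHom.id _)
      (hom_ext fun m n => congrArg (tmul S m) (one_smul Cᵐᵒᵖ n))
    mul_smul := fun a b => DFunLike.congr_fun (f := φ (a * b)) (g := (φ a).comp (φ b))
      (hom_ext fun m n => congrArg (tmul S m) (mul_smul a b n))
    smul_zero := fun c => map_zero (φ c)
    smul_add := fun c => map_add (φ c)
    add_smul := fun a b => DFunLike.congr_fun (f := φ (a + b)) (g := φ a + φ b)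
      (hom_ext fun m n => (congrArg (tmul S m) (add_smul a b n)).trans (tmul_add _ _ _))
    zero_smul := DFunLike.congr_fun (f := φ 0) (g := 0)
      (hom_ext fun m n => (congrArg (tmul S m) (zero_smul Cᵐᵒᵖ n)).trans (tmul_zero _)) }

end BalTensor

end Balanced

/-! ### Bimodules -/

/-- An `A`-`R`-bimodule: commuting left `A`- and right `R`-actions. -/
structure Bimodule (A R : Type u) [Ring A] [Ring R] where
  /-- the underlying type -/
  carrier : Type u
  [addCommGroup : AddCommGroup carrier]
  [leftModule : Module A carrier]
  [rightModule : Module Rᵐᵒᵖ carrier]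
  [smulComm : SMulCommClass A Rᵐᵒᵖ carrier]

namespace Bimodule

attribute [instance] addCommGroup leftModule rightModule smulComm

/-- An isomorphism of `A`-`R`-bimodules. -/
structure Iso {A R : Type u} [Ring A] [Ring R] (P Q : Bimodule A R) where
  /-- the underlying additive isomorphism -/
  toAddEquiv : P.carrier ≃+ Q.carrier
  map_smul : ∀ (a : A) (x : P.carrier), toAddEquiv (a • x) = a • toAddEquiv x
  map_op_smul : ∀ (r : R) (x : P.carrier), toAddEquiv (op r • x) = op r • toAddEquiv x

/-- The natural bimodule `_A A_A`. -/
def regular (A : Type u) [Ring A] : Bimodule A A where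
  carrier := A

/-- Restriction of an `A`-`R`-bimodule to a `B`-`S`-bimodule along `B → A` and `S → R`. -/
def restrict {A B R S : Type u} [Ring A] [Ring B] [Ring R] [Ring S]
    (f : B →+* A) (g : S →+* R) (P : Bimodule A R) : Bimodule B S :=
  letI : Module B P.carrier := Module.compHom P.carrier f
  letI : Module Sᵐᵒᵖ P.carrier := Module.compHom P.carrier (RingHom.op g)
  { carrier := P.carrier
    smulComm := ⟨fun b s x => smul_comm (f b) (RingHom.op g s) x⟩ }

/-- The tensor product `_A P ⊗_R Q_C` of bimodules `_A P_R` and `_R Q_C`. -/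
noncomputable def tensor {A R C : Type u} [Ring A] [Ring R] [Ring C]
    (P : Bimodule A R) (Q : Bimodule R C) : Bimodule A C :=
  letI : Module A (BalTensor R P.carrier Q.carrier) := BalTensor.leftModule A R _ _
  letI : Module Cᵐᵒᵖ (BalTensor R P.carrier Q.carrier) := BalTensor.rightModule R C _ _
  { carrier := BalTensor R P.carrier Q.carrier
    smulComm := ⟨fun a c x => by
      induction x using BalTensor.induction_on with
      | zero => simp
      | tmul m n => rfl
      | add x y hx hy => simp only [smul_add, hx, hy]⟩ }

/-- The right action `(φ a)(p) = φ (a p)` of `A` on `Hom(P_R, R_R)`. -/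
@[reducible]
def dualRightModule {A R : Type u} [Ring A] [Ring R] (P : Bimodule A R) :
    Module Aᵐᵒᵖ (P.carrier →ₗ[Rᵐᵒᵖ] R) where
  smul a φ := φ ∘ₗ Module.toModuleEnd Rᵐᵒᵖ (S := A) P.carrier (unop a)
  one_smul φ := LinearMap.ext fun x => congrArg φ (one_smul A x)
  mul_smul a b φ := LinearMap.ext fun x => congrArg φ (mul_smul (unop b) (unop a) x)
  smul_zero _ := rfl
  smul_add _ _ _ := rfl
  add_smul a b φ := LinearMap.ext fun x =>
    (congrArg φ (add_smul (unop a) (unop b) x)).trans (map_add φ _ _)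
  zero_smul φ := LinearMap.ext fun x => (congrArg φ (zero_smul A x)).trans (map_zero φ)

/-- The dual `P^* = Hom(P_R, R_R)` of `_A P_R`, an `R`-`A`-bimodule by
`(r φ a)(p) = r φ(a p)`. -/
def dual {A R : Type u} [Ring A] [Ring R] (P : Bimodule A R) : Bimodule R A :=
  letI : Module Aᵐᵒᵖ (P.carrier →ₗ[Rᵐᵒᵖ] R) := P.dualRightModule
  { carrier := P.carrier →ₗ[Rᵐᵒᵖ] R
    smulComm := ⟨fun _ _ _ => rfl⟩ }

/-- `_A P_R` is a Morita bimodule if it is invertible: there is a bimodule `_R P'_A` with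
`P ⊗_R P' ≅ A` and `P' ⊗_A P ≅ R` as bimodules. -/
def IsMorita {A R : Type u} [Ring A] [Ring R] (P : Bimodule A R) : Prop :=
  ∃ P' : Bimodule R A,
    Nonempty (Iso (P.tensor P') (regular A)) ∧ Nonempty (Iso (P'.tensor P) (regular R))

/-- The functor `P ⊗_R - ` from left `R`-modules to left `A`-modules. -/
noncomputable def tensorFunctor {A R : Type u} [Ring A] [Ring R] (P : Bimodule A R) :
    ModuleCat.{u} R ⥤ ModuleCat.{u} A where
  obj X :=
    letI : Module A (BalTensor R P.carrier X) := BalTensor.leftModule A R _ _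
    ModuleCat.of A (BalTensor R P.carrier X)
  map {X Y} h :=
    letI : Module A (BalTensor R P.carrier X) := BalTensor.leftModule A R _ _
    letI : Module A (BalTensor R P.carrier Y) := BalTensor.leftModule A R _ _
    ModuleCat.ofHom
      { toFun := BalTensor.map LinearMap.id h.hom
        map_add' := map_add _
        map_smul' := fun a x => by
          induction x using BalTensor.induction_on with
          | zero => simp
          | tmul m n => rfl
          | add x y hx hy => simp only [smul_add, map_add, hx, hy] }
  map_id X := by
    refine ConcreteCategory.hom_ext _ _ fun x => ?_
    exact DFunLike.congr_fun (BalTensor.map_id_id (S := R) (M := P.carrier) (N := X)) x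
  map_comp h k := by
    refine ConcreteCategory.hom_ext _ _ fun x => ?_
    exact DFunLike.congr_fun (BalTensor.map_comp_comp (S := R)
      (LinearMap.id : P.carrier →ₗ[Rᵐᵒᵖ] P.carrier) LinearMap.id h.hom k.hom) x

end Bimodule

/-! ### Restriction, induction and coinduction along a ring extension `f : B → A` -/

section Functors

variable {A B : Type u} [Ring A] [Ring B]

/-- Restriction of left `A`-modules to left `B`-modules. -/
noncomputable abbrev Res (f : B →+* A) : ModuleCat.{u} A ⥤ ModuleCat.{u} B :=
  ModuleCat.restrictScalars f

/-- Induction `A ⊗_B -` of left `B`-modules to left `A`-modules. -/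
noncomputable abbrev Ind (f : B →+* A) : ModuleCat.{u} B ⥤ ModuleCat.{u} A :=
  ((Bimodule.regular A).restrict (RingHom.id A) f).tensorFunctor

/-- Coinduction `Hom(_B A, _B -)` of left `B`-modules to left `A`-modules. -/
noncomputable abbrev Coind (f : B →+* A) : ModuleCat.{u} B ⥤ ModuleCat.{u} A :=
  ModuleCat.coextendScalars f

end Functors

/-! ### The conditions on two ring extensions `f : B → A` and `g : S → R`

The conditions for right modules are the same ones for the opposite extensions
`f.op : Bᵐᵒᵖ → Aᵐᵒᵖ` and `g.op : Sᵐᵒᵖ → Rᵐᵒᵖ`. -/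

section Conditions

variable {A B R S : Type u} [Ring A] [Ring B] [Ring R] [Ring S]

open Bimodule

/-- Morita equivalence of ring extensions: there are additive equivalences `𝓕` from left
`R`-modules to left `A`-modules and `𝓖` from left `S`-modules to left `B`-modules that commute
with restriction. -/
def MoritaEquivalent (f : B →+* A) (g : S →+* R) : Prop :=
  ∃ (𝓕 : ModuleCat.{u} R ≌ ModuleCat.{u} A) (𝓖 : ModuleCat.{u} S ≌ ModuleCat.{u} B),
    𝓕.functor.Additive ∧ 𝓖.functor.Additive ∧
      Nonempty (Res g ⋙ 𝓖.functor ≅ 𝓕.functor ⋙ Res f)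

/-- Additive equivalences commuting with induction. -/
def CommutesInd (f : B →+* A) (g : S →+* R) : Prop :=
  ∃ (𝓕 : ModuleCat.{u} R ≌ ModuleCat.{u} A) (𝓖 : ModuleCat.{u} S ≌ ModuleCat.{u} B),
    𝓕.functor.Additive ∧ 𝓖.functor.Additive ∧
      Nonempty (Ind g ⋙ 𝓕.functor ≅ 𝓖.functor ⋙ Ind f)

/-- Additive equivalences commuting with coinduction. -/
def CommutesCoind (f : B →+* A) (g : S →+* R) : Prop :=
  ∃ (𝓕 : ModuleCat.{u} R ≌ ModuleCat.{u} A) (𝓖 : ModuleCat.{u} S ≌ ModuleCat.{u} B),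
    𝓕.functor.Additive ∧ 𝓖.functor.Additive ∧
      Nonempty (Coind g ⋙ 𝓕.functor ≅ 𝓖.functor ⋙ Coind f)

/-- Morita bimodules `_A P_R`, `_B Q_S` with `_B Q ⊗_S R_R ≅ _B P_R`. -/
def BimoduleQR (f : B →+* A) (g : S →+* R) : Prop :=
  ∃ (P : Bimodule A R) (Q : Bimodule B S), P.IsMorita ∧ Q.IsMorita ∧
    Nonempty (Iso (Q.tensor ((regular R).restrict g (RingHom.id R)))
      (P.restrict f (RingHom.id R)))

/-- Morita bimodules `_A P_R`, `_B Q_S` with `_R R ⊗_S Q^*_B ≅ _R P^*_B`. -/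
def BimoduleRQdual (f : B →+* A) (g : S →+* R) : Prop :=
  ∃ (P : Bimodule A R) (Q : Bimodule B S), P.IsMorita ∧ Q.IsMorita ∧
    Nonempty (Iso (((regular R).restrict (RingHom.id R) g).tensor Q.dual)
      (P.dual.restrict (RingHom.id R) f))

/-- Morita bimodules `_A P_R`, `_B Q_S` with `_A A ⊗_B Q_S ≅ _A P_S`. -/
def BimoduleAQ (f : B →+* A) (g : S →+* R) : Prop :=
  ∃ (P : Bimodule A R) (Q : Bimodule B S), P.IsMorita ∧ Q.IsMorita ∧
    Nonempty (Iso (((regular A).restrict (RingHom.id A) f).tensor Q)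
      (P.restrict (RingHom.id A) g))

/-- Morita bimodules `_A P_R`, `_B Q_S` with `_S Q^* ⊗_B A_A ≅ _S P^*_A`. -/
def BimoduleQdualA (f : B →+* A) (g : S →+* R) : Prop :=
  ∃ (P : Bimodule A R) (Q : Bimodule B S), P.IsMorita ∧ Q.IsMorita ∧
    Nonempty (Iso (Q.dual.tensor ((regular A).restrict f (RingHom.id A)))
      (P.dual.restrict g (RingHom.id A)))

end Conditions

end MoritaExt

/-! Everything is reduced to condition (1) by turning functors into bimodules. The bridge is the
Eilenberg-Watts theorem (`eilenbergWatts`): an additive functor `F` on left `R`-modules with a right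
adjoint is `F(R) ⊗_R -`. Hence additive equivalences correspond to Morita bimodules, and natural
isomorphisms of tensor functors correspond to bimodule isomorphisms. Since restriction, induction
and their composites with equivalences are tensor functors, (1) translates into (2) and (6) into
(4).

Restriction lies in the adjoint triple `Ind ⊣ Res ⊣ Coind`. Taking left or right adjoints of both
sides of (1) gives (6) or (7) with the two extensions exchanged, and (1) is symmetric in the
extensions.

For (3) and (5), the dual of an invertible bimodule is its inverse (`dualIsoInverse`), so up to
isomorphism Morita bimodules are exactly the duals of Morita bimodules. This makes (3) and (5) the
conditions (4) and (2) for the exchanged pair.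

For right modules, an `A`-`R`-bimodule is an `Rᵐᵒᵖ`-`Aᵐᵒᵖ`-bimodule, and the passage reverses tensor
products. It carries (2) for the opposite extensions to (4) for the exchanged pair
(`bimoduleQR_op_iff`), which settles all the opposite conditions at once. -/

namespace MoritaExt

/-! ### Universal property and right unit of the balanced tensor product. -/

namespace BalTensor

section

variable {S M N G : Type*} [Ring S] [AddCommGroup M] [AddCommGroup N] [Module Sᵐᵒᵖ M]
  [Module S N] [AddCommGroup G]

/-- The universal property of `M ⊗_S N`. -/
noncomputable def lift (φ : M →+ N →+ G) (h : ∀ m (s : S) n, φ (op s • m) n = φ m (s • n)) :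
    BalTensor S M N →+ G :=
  QuotientAddGroup.lift (balancedRel S M N)
    (TensorProduct.liftAddHom φ fun z m n => by simp)
    (by
      refine (AddSubgroup.closure_le _).2 ?_
      rintro _ ⟨m, s, n, rfl⟩
      simp [AddMonoidHom.mem_ker, h])

@[simp]
theorem lift_tmul (φ : M →+ N →+ G) (h : ∀ m (s : S) n, φ (op s • m) n = φ m (s • n))
    (m : M) (n : N) : lift φ h (tmul S m n) = φ m n := rfl

theorem hom_congr {φ ψ : BalTensor S M N →+ G}
    (h : ∀ m n, φ (tmul S m n) = ψ (tmul S m n)) (x : BalTensor S M N) : φ x = ψ x :=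
  DFunLike.congr_fun (hom_ext h) x

/-- The biadditive map `(m, n) ↦ m ⊗ n`. -/
noncomputable def tmulHom (S M N : Type*) [Ring S] [AddCommGroup M] [AddCommGroup N]
    [Module Sᵐᵒᵖ M] [Module S N] : M →+ N →+ BalTensor S M N where
  toFun m :=
    { toFun := fun n => tmul S m n
      map_zero' := tmul_zero m
      map_add' := tmul_add m }
  map_zero' := AddMonoidHom.ext fun n => zero_tmul n
  map_add' _ _ := AddMonoidHom.ext fun n => add_tmul _ _ n

/-- The isomorphism `M ⊗_S S ≅ M`. -/
noncomputable def rid (S M : Type*) [Ring S] [AddCommGroup M] [Module Sᵐᵒᵖ M] :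
    BalTensor S M S ≃+ M where
  toFun := lift
    (AddMonoidHom.mk' (fun m => AddMonoidHom.mk' (fun s : S => op s • m)
      fun s t => add_smul (op s) (op t) m)
      fun m n => AddMonoidHom.ext fun s => smul_add (op s) m n)
    fun m s t => by simp [mul_smul]
  invFun m := tmul S m 1
  left_inv x := by
    induction x using induction_on with
    | zero => simp [zero_tmul]
    | tmul m s => simp [smul_tmul]
    | add x y hx hy =>
      exact (congrArg (tmul S · 1) (map_add (lift _ _) x y)).trans
        ((add_tmul _ _ _).trans (congrArg₂ _ hx hy))
  right_inv m := by simp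
  map_add' := map_add _

end

end BalTensor

/-! ### Tensor-hom adjunction. -/

namespace Bimodule

variable {A R C : Type u} [Ring A] [Ring R] [Ring C]

theorem tensorFunctor_hom_ext {P : Bimodule A R} {X : ModuleCat.{u} R} {Y : ModuleCat.{u} A}
    {h k : P.tensorFunctor.obj X ⟶ Y}
    (H : ∀ (p : P.carrier) (x : X), h.hom (BalTensor.tmul R p x : BalTensor R P.carrier X) =
      k.hom (BalTensor.tmul R p x : BalTensor R P.carrier X)) : h = k :=
  ConcreteCategory.hom_ext _ _ (BalTensor.hom_congr (φ := h.hom.toAddMonoidHom)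
    (ψ := k.hom.toAddMonoidHom) H)

instance (P : Bimodule A R) : P.tensorFunctor.Additive where
  map_add := tensorFunctor_hom_ext fun p _ => BalTensor.tmul_add p _ _

/-- The left `R`-module structure `(r φ)(p) = φ(p r)` on `Hom(_A P, _A Y)`. -/
@[reducible]
def homModule (P : Bimodule A R) (Y : Type u) [AddCommGroup Y] [Module A Y] :
    Module R (P.carrier →ₗ[A] Y) where
  smul r φ := φ ∘ₗ (haveI : SMulCommClass Rᵐᵒᵖ A P.carrier := SMulCommClass.symm _ _ _
    Module.toModuleEnd A (S := Rᵐᵒᵖ) P.carrier (op r))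
  one_smul φ := LinearMap.ext fun x => congrArg φ (one_smul Rᵐᵒᵖ x)
  mul_smul r s φ := LinearMap.ext fun x => congrArg φ (mul_smul (op s) (op r) x)
  smul_zero _ := rfl
  smul_add _ _ _ := rfl
  add_smul r s φ := LinearMap.ext fun x =>
    (congrArg φ (add_smul (op r) (op s) x)).trans (map_add φ _ _)
  zero_smul φ := LinearMap.ext fun x => (congrArg φ (zero_smul Rᵐᵒᵖ x)).trans (map_zero φ)

/-- The functor `Hom(_A P, -)` from left `A`-modules to left `R`-modules. -/
def homFunctor (P : Bimodule A R) : ModuleCat.{u} A ⥤ ModuleCat.{u} R where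
  obj Y :=
    letI : Module R (P.carrier →ₗ[A] Y) := P.homModule Y
    ModuleCat.of R (P.carrier →ₗ[A] Y)
  map {Y Z} h :=
    letI : Module R (P.carrier →ₗ[A] Y) := P.homModule Y
    letI : Module R (P.carrier →ₗ[A] Z) := P.homModule Z
    ModuleCat.ofHom
      { toFun := fun φ => h.hom ∘ₗ φ
        map_add' := fun φ ψ => LinearMap.comp_add φ ψ h.hom
        map_smul' := fun _ _ => rfl }
  map_id _ := rfl
  map_comp _ _ := rfl

instance (P : Bimodule A R) : P.homFunctor.Additive where
  map_add := rfl

/-- Tensor-hom adjunction, on hom-sets. -/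
noncomputable def tensorHomEquiv (P : Bimodule A R) (X : ModuleCat.{u} R) (Y : ModuleCat.{u} A) :
    (P.tensorFunctor.obj X ⟶ Y) ≃ (X ⟶ P.homFunctor.obj Y) where
  toFun h :=
    letI : Module R (P.carrier →ₗ[A] Y) := P.homModule Y
    ModuleCat.ofHom (X := X) (Y := (P.carrier →ₗ[A] Y))
      { toFun := fun x =>
          { toFun := fun p => h.hom (BalTensor.tmul R p x : BalTensor R P.carrier X)
            map_add' := fun p q =>
              (congrArg h.hom (BalTensor.add_tmul p q x)).trans (map_add h.hom _ _)
            map_smul' := fun a p =>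
              h.hom.map_smul a (BalTensor.tmul R p x : BalTensor R P.carrier X) }
        map_add' := fun x y => LinearMap.ext fun p =>
          (congrArg h.hom (BalTensor.tmul_add p x y)).trans (map_add h.hom _ _)
        map_smul' := fun r x => LinearMap.ext fun p =>
          (congrArg h.hom (BalTensor.smul_tmul p r x)).symm }
  invFun k :=
    letI : Module A (BalTensor R P.carrier X) := BalTensor.leftModule A R _ _
    let k' : X → P.carrier →ₗ[A] Y := fun x => k.hom x
    have hadd : ∀ x y, k' (x + y) = k' x + k' y := map_add k.hom
    -- The `R`-linearity of `k` is precisely the balancedness needed to descend to `P ⊗_R X`.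
    have hsmul : ∀ (r : R) x p, k' (r • x) p = k' x (op r • p) := fun r x p =>
      LinearMap.congr_fun (k.hom.map_smul r x) p
    let l : BalTensor R P.carrier X →+ Y := BalTensor.lift
      (AddMonoidHom.mk' (fun p => AddMonoidHom.mk' (fun x => k' x p)
        fun x y => LinearMap.congr_fun (hadd x y) p)
        fun p q => AddMonoidHom.ext fun x => map_add (k' x) p q)
      fun p r x => (hsmul r x p).symm
    ModuleCat.ofHom (X := BalTensor R P.carrier X) (Y := Y)
      { toFun := l
        map_add' := map_add l
        map_smul' := fun a t => by
          induction t using BalTensor.induction_on with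
          | zero => simp
          | tmul p x => exact (k' x).map_smul a p
          | add x y hx hy => simp only [smul_add, map_add, hx, hy] }
  left_inv h := tensorFunctor_hom_ext fun _ _ => rfl
  right_inv k := rfl

/-- The functor `P ⊗_R -` is left adjoint to `Hom(_A P, -)`. -/
noncomputable def tensorHomAdj (P : Bimodule A R) : P.tensorFunctor ⊣ P.homFunctor :=
  Adjunction.mkOfHomEquiv
    { homEquiv := P.tensorHomEquiv
      homEquiv_naturality_left_symm := fun _ _ => tensorFunctor_hom_ext fun _ _ => rfl
      homEquiv_naturality_right := fun _ _ => rfl }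

/-! ### The bimodule of an additive functor -/

/-- The action of `Rᵐᵒᵖ` on `F(R)`. -/
def endHom (F : ModuleCat.{u} R ⥤ ModuleCat.{u} A) [F.Additive] :
    Rᵐᵒᵖ →+* Module.End A (F.obj (ModuleCat.of R R)) where
  toFun c := (F.map (ModuleCat.ofHom (Module.toModuleEnd R (S := Rᵐᵒᵖ) R c))).hom
  map_one' := by
    rw [map_one]
    exact congrArg ModuleCat.Hom.hom (F.map_id (ModuleCat.of R R))
  map_mul' c d := by
    rw [map_mul]
    exact congrArg ModuleCat.Hom.hom (F.map_comp
      (ModuleCat.ofHom (Module.toModuleEnd R (S := Rᵐᵒᵖ) R d))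
      (ModuleCat.ofHom (Module.toModuleEnd R (S := Rᵐᵒᵖ) R c)))
  map_zero' := by
    rw [map_zero]
    exact congrArg ModuleCat.Hom.hom (F.map_zero (ModuleCat.of R R) (ModuleCat.of R R))
  map_add' c d := by
    rw [map_add]
    exact congrArg ModuleCat.Hom.hom (F.map_add
      (f := ModuleCat.ofHom (Module.toModuleEnd R (S := Rᵐᵒᵖ) R c))
      (g := ModuleCat.ofHom (Module.toModuleEnd R (S := Rᵐᵒᵖ) R d)))

/-- The `A`-`R`-bimodule `F(R)` of an additive functor `F` from left `R`-modules to
left `A`-modules. -/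
def ofFunctor (F : ModuleCat.{u} R ⥤ ModuleCat.{u} A) [F.Additive] : Bimodule A R :=
  letI : Module Rᵐᵒᵖ (F.obj (ModuleCat.of R R)) := Module.compHom _ (endHom F)
  { carrier := F.obj (ModuleCat.of R R)
    smulComm := ⟨fun a c x => ((endHom F c).map_smul a x).symm⟩ }

namespace Iso

/-- The identity. -/
def refl (P : Bimodule A R) : Iso P P := ⟨AddEquiv.refl _, fun _ _ => rfl, fun _ _ => rfl⟩

/-- The inverse isomorphism. -/
def symm {P Q : Bimodule A R} (e : Iso P Q) : Iso Q P where
  toAddEquiv := e.toAddEquiv.symm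
  map_smul a x := by
    rw [AddEquiv.symm_apply_eq, e.map_smul, AddEquiv.apply_symm_apply]
  map_op_smul a x := by
    rw [AddEquiv.symm_apply_eq, e.map_op_smul, AddEquiv.apply_symm_apply]

/-- The composition of isomorphisms. -/
def trans {P Q T : Bimodule A R} (e : Iso P Q) (e' : Iso Q T) : Iso P T where
  toAddEquiv := e.toAddEquiv.trans e'.toAddEquiv
  map_smul a x := by simp [e.map_smul, e'.map_smul]
  map_op_smul a x := by simp [e.map_op_smul, e'.map_op_smul]

/-- The isomorphism of left modules underlying an isomorphism of bimodules. -/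
def toModuleIso {P Q : Bimodule A R} (e : Iso P Q) :
    ModuleCat.of A P.carrier ≅ ModuleCat.of A Q.carrier :=
  LinearEquiv.toModuleIso { e.toAddEquiv with map_smul' := e.map_smul }

/-- The right linear map underlying an isomorphism of bimodules. -/
def toRight {P Q : Bimodule A R} (e : Iso P Q) : P.carrier →ₗ[Rᵐᵒᵖ] Q.carrier where
  toFun := e.toAddEquiv
  map_add' := map_add _
  map_smul' c x := e.map_op_smul (unop c) x

end Iso

/-- Isomorphic functors have isomorphic bimodules. -/
def isoOfFunctorIso {F G : ModuleCat.{u} R ⥤ ModuleCat.{u} A} [F.Additive] [G.Additive]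
    (e : F ≅ G) : Iso (ofFunctor F) (ofFunctor G) where
  toAddEquiv := (e.app (ModuleCat.of R R)).toLinearEquiv.toAddEquiv
  map_smul a x := (e.app (ModuleCat.of R R)).toLinearEquiv.map_smul a x
  -- Right multiplication by `r` is an endomorphism of the left module `R`, so right linearity is
  -- naturality at that morphism.
  map_op_smul r x := ConcreteCategory.congr_hom
    (e.hom.naturality (ModuleCat.ofHom (Module.toModuleEnd R (S := Rᵐᵒᵖ) R (op r)))) x

/-- The bimodule of `P ⊗_R -` is `P`. -/
noncomputable def ofTensorFunctor (P : Bimodule A R) : Iso (ofFunctor P.tensorFunctor) P where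
  toAddEquiv := BalTensor.rid R P.carrier
  map_smul a x := by
    refine DFunLike.congr_fun (f := (BalTensor.rid R P.carrier).toAddMonoidHom.comp
        (BalTensor.map (Module.toModuleEnd Rᵐᵒᵖ (S := A) P.carrier a) LinearMap.id))
      (g := (DistribSMul.toAddMonoidHom P.carrier a).comp
        (BalTensor.rid R P.carrier).toAddMonoidHom) (BalTensor.hom_ext fun p r => ?_) x
    exact (smul_comm a (op r) p).symm
  map_op_smul s x := by
    refine DFunLike.congr_fun (f := (BalTensor.rid R P.carrier).toAddMonoidHom.comp
        (BalTensor.map LinearMap.id (Module.toModuleEnd R (S := Rᵐᵒᵖ) R (op s))))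
      (g := (DistribSMul.toAddMonoidHom P.carrier (op s)).comp
        (BalTensor.rid R P.carrier).toAddMonoidHom) (BalTensor.hom_ext fun p r => ?_) x
    exact mul_smul (op s) (op r) p

/-! ### The Eilenberg-Watts theorem. -/

/-- Elements of `X` are morphisms `R → X`. -/
noncomputable def elementHom (X : ModuleCat.{u} R) : X ≃+ (ModuleCat.of R R ⟶ X) where
  toFun x := ModuleCat.ofHom (LinearMap.toSpanSingleton R X x)
  invFun h := h.hom (1 : R)
  left_inv x := one_smul R x
  right_inv h := ModuleCat.hom_ext (LinearMap.ext_ring (one_smul R _))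
  map_add' x y := ModuleCat.hom_ext (LinearMap.ext_ring (by simp))

/-- Expresses the action on `X` by a morphism of the source `R`, so that it can be carried through
the naturality of an adjunction. -/
theorem elementHom_smul (X : ModuleCat.{u} R) (r : R) (x : X) :
    elementHom X (r • x) =
      ModuleCat.ofHom (Module.toModuleEnd R (S := Rᵐᵒᵖ) R (op r)) ≫ elementHom X x :=
  ModuleCat.hom_ext (LinearMap.ext_ring
    ((one_smul R (r • x)).trans (congrArg (· • x) (one_mul r).symm)))

theorem elementHom_map {X Y : ModuleCat.{u} R} (h : X ⟶ Y) (x : X) :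
    elementHom Y (h.hom x) = elementHom X x ≫ h :=
  ModuleCat.hom_ext (LinearMap.ext_ring
    ((one_smul R (h.hom x)).trans (congrArg h.hom (one_smul R x).symm)))

/-- A right adjoint of `F` is `Hom(_A F(R), -)`. -/
noncomputable def homFunctorIso {F : ModuleCat.{u} R ⥤ ModuleCat.{u} A} [F.Additive]
    {G : ModuleCat.{u} A ⥤ ModuleCat.{u} R} (adj : F ⊣ G) :
    G ≅ (ofFunctor F).homFunctor :=
  NatIso.ofComponents (fun Y =>
    letI : Module R ((ofFunctor F).carrier →ₗ[A] Y) := (ofFunctor F).homModule Y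
    -- `G(Y) ≅ Hom_R(R, G(Y)) ≅ Hom_A(F(R), Y)`; naturality in the first variable gives
    -- `R`-linearity, and in the second naturality in `Y`.
    let e : G.obj Y ≃+ (F.obj (ModuleCat.of R R) ⟶ Y) :=
      (elementHom (G.obj Y)).trans (adj.homAddEquiv (ModuleCat.of R R) Y).symm
    LinearEquiv.toModuleIso (X₁ := G.obj Y) (X₂ := ((ofFunctor F).carrier →ₗ[A] Y))
      { (e.toEquiv.trans ModuleCat.homEquiv : G.obj Y ≃ ((ofFunctor F).carrier →ₗ[A] Y)) with
        map_add' := fun x y => congrArg ModuleCat.Hom.hom (map_add e x y)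
        map_smul' := fun r x => congrArg ModuleCat.Hom.hom
          ((congrArg (adj.homEquiv (ModuleCat.of R R) Y).symm (elementHom_smul _ r x)).trans
            (adj.homEquiv_naturality_left_symm _ _)) })
    fun {_ Z} h => ConcreteCategory.hom_ext _ _ fun x => congrArg ModuleCat.Hom.hom
      ((congrArg (adj.homEquiv (ModuleCat.of R R) Z).symm (elementHom_map (G.map h) x)).trans
        (adj.homEquiv_naturality_right_symm _ _))

/-- The Eilenberg-Watts theorem: an additive functor `F` with a right adjoint is isomorphic to
`F(R) ⊗_R -`. -/
noncomputable def eilenbergWatts {F : ModuleCat.{u} R ⥤ ModuleCat.{u} A} [F.Additive]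
    {G : ModuleCat.{u} A ⥤ ModuleCat.{u} R} (adj : F ⊣ G) :
    F ≅ (ofFunctor F).tensorFunctor :=
  -- `F` and `F(R) ⊗_R -` are both left adjoint to `Hom(_A F(R), -)`, so no presentation of modules
  -- is needed.
  (adj.ofNatIsoRight (homFunctorIso adj)).leftAdjointUniq (tensorHomAdj _)

/-- Isomorphic bimodules have isomorphic tensor functors. -/
noncomputable def Iso.tensorFunctorIso {P Q : Bimodule A R} (e : Iso P Q) :
    P.tensorFunctor ≅ Q.tensorFunctor :=
  letI l {P Q : Bimodule A R} (e : Iso P Q) : P.tensorFunctor ⟶ Q.tensorFunctor :=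
    { app := fun X =>
        letI : Module A (BalTensor R P.carrier X) := BalTensor.leftModule A R _ _
        letI : Module A (BalTensor R Q.carrier X) := BalTensor.leftModule A R _ _
        ModuleCat.ofHom (X := BalTensor R P.carrier X) (Y := BalTensor R Q.carrier X)
          { toFun := BalTensor.map e.toRight LinearMap.id
            map_add' := map_add _
            map_smul' := fun a x => by
              induction x using BalTensor.induction_on with
              | zero => simp
              | tmul p x => exact congrArg (BalTensor.tmul R · x) (e.map_smul a p)
              | add x y hx hy => simp only [smul_add, map_add, hx, hy] }
      naturality := fun _ _ _ => tensorFunctor_hom_ext fun _ _ => rfl }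
  { hom := l e
    inv := l e.symm
    hom_inv_id := NatTrans.ext (funext fun _ => tensorFunctor_hom_ext fun p x =>
      congrArg (BalTensor.tmul R · x) (e.toAddEquiv.symm_apply_apply p))
    inv_hom_id := NatTrans.ext (funext fun _ => tensorFunctor_hom_ext fun p x =>
      congrArg (BalTensor.tmul R · x) (e.toAddEquiv.apply_symm_apply p)) }

/-- Bimodules with isomorphic tensor functors are isomorphic. -/
noncomputable def isoOfTensorFunctorIso {P Q : Bimodule A R}
    (e : P.tensorFunctor ≅ Q.tensorFunctor) : Iso P Q :=
  (ofTensorFunctor P).symm.trans ((isoOfFunctorIso e).trans (ofTensorFunctor Q))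

/-- The Eilenberg-Watts theorem, for a given bimodule isomorphic to `F(R)`. -/
noncomputable def functorIsoTensor {F : ModuleCat.{u} R ⥤ ModuleCat.{u} A} [F.Additive]
    {G : ModuleCat.{u} A ⥤ ModuleCat.{u} R} (adj : F ⊣ G) {P : Bimodule A R}
    (e : Iso (ofFunctor F) P) : F ≅ P.tensorFunctor :=
  eilenbergWatts adj ≪≫ e.tensorFunctorIso

/-! ### Tensor products and restrictions of bimodules -/

/-- The isomorphism `P ⊗_R (Q ⊗_C -) ≅ (P ⊗_R Q) ⊗_C -`. -/
noncomputable def tensorFunctorTensor (P : Bimodule A R) (Q : Bimodule R C) :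
    Q.tensorFunctor ⋙ P.tensorFunctor ≅ (P.tensor Q).tensorFunctor :=
  -- Associativity follows from Eilenberg-Watts: the composite has a right adjoint, so only its
  -- value `P ⊗_R (Q ⊗_C C) ≅ P ⊗_R Q` on the regular module has to be identified.
  functorIsoTensor (Q.tensorHomAdj.comp P.tensorHomAdj)
    (letI e : Q.tensorFunctor.obj (ModuleCat.of C C) ≅ ModuleCat.of R Q.carrier :=
      Q.ofTensorFunctor.toModuleIso
    { toAddEquiv := (P.tensorFunctor.mapIso e).toLinearEquiv.toAddEquiv
      map_smul := (P.tensorFunctor.map e.hom).hom.map_smul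
      map_op_smul := fun c x => by
        have : SMulCommClass Cᵐᵒᵖ R Q.carrier := SMulCommClass.symm _ _ _
        have h : Q.tensorFunctor.map
            (ModuleCat.ofHom (Module.toModuleEnd C (S := Cᵐᵒᵖ) C (op c))) ≫ e.hom =
            e.hom ≫ ModuleCat.ofHom (Module.toModuleEnd R (S := Cᵐᵒᵖ) Q.carrier (op c)) :=
          ConcreteCategory.hom_ext _ _ fun x => Q.ofTensorFunctor.map_op_smul c x
        exact ConcreteCategory.congr_hom ((P.tensorFunctor.map_comp _ _).symm.trans
          ((congrArg P.tensorFunctor.map h).trans (P.tensorFunctor.map_comp _ _))) x })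

/-- `A ⊗_A -` is the identity functor. -/
noncomputable def tensorFunctorRegular (A : Type u) [Ring A] :
    𝟭 (ModuleCat.{u} A) ≅ (regular A).tensorFunctor :=
  functorIsoTensor Adjunction.id
    { toAddEquiv := AddEquiv.refl A
      map_smul := fun _ _ => rfl
      map_op_smul := fun _ _ => rfl }

end Bimodule

/-! ### Exchanging the factors of a tensor product. -/

namespace BalTensor

variable {S T M N : Type*} [Ring S] [Ring T] [AddCommGroup M] [AddCommGroup N]
  [Module Sᵐᵒᵖ M] [Module S N] [Module Tᵐᵒᵖ N] [Module T M]

/-- The map `M ⊗_S N → N ⊗_T M`, `m ⊗ n ↦ n ⊗ m`. -/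
noncomputable def flip
    (h : ∀ (m : M) (s : S) (n : N), tmul T n (op s • m) = tmul T (s • n) m) :
    BalTensor S M N →+ BalTensor T N M :=
  lift (tmulHom T N M).flip h

/-- The isomorphism `M ⊗_S N ≅ N ⊗_T M`, `m ⊗ n ↦ n ⊗ m`. -/
noncomputable def flipEquiv
    (h : ∀ (m : M) (s : S) (n : N), tmul T n (op s • m) = tmul T (s • n) m)
    (h' : ∀ (n : N) (t : T) (m : M), tmul S m (op t • n) = tmul S (t • m) n) :
    BalTensor S M N ≃+ BalTensor T N M :=
  AddMonoidHom.toAddEquiv (flip h) (flip h') (hom_ext fun _ _ => rfl) (hom_ext fun _ _ => rfl)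

end BalTensor

/-! ### Restriction as a right adjoint. -/

/-- The isomorphism `Hom(_A A, -) ≅ Res`. -/
noncomputable def homResIso {A B : Type u} [Ring A] [Ring B] (f : B →+* A) :
    Res f ≅ ((Bimodule.regular A).restrict (RingHom.id A) f).homFunctor :=
  NatIso.ofComponents (fun (Y : ModuleCat.{u} A) =>
    letI P := (Bimodule.regular A).restrict (RingHom.id A) f
    letI : Module B Y := Module.compHom Y f
    letI : Module B (P.carrier →ₗ[A] Y) := P.homModule Y
    letI e : Y ≃ (P.carrier →ₗ[A] Y) :=
      (Bimodule.elementHom Y).toEquiv.trans ModuleCat.homEquiv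
    LinearEquiv.toModuleIso (X₁ := Y) (X₂ := (P.carrier →ₗ[A] Y))
      { e with
        map_add' := fun x y => LinearMap.ext fun a : A => smul_add a x y
        map_smul' := fun b x => LinearMap.ext fun a : A => smul_smul a (f b) x })
    fun {X Y} h => ConcreteCategory.hom_ext _ _ fun x => LinearMap.ext fun a : A =>
      ((ModuleCat.Hom.hom (R := A) (A := X) (B := Y) h).map_smul a x).symm

/-- Induction is left adjoint to restriction. -/
noncomputable def indResAdj {A B : Type u} [Ring A] [Ring B] (f : B →+* A) : Ind f ⊣ Res f :=
  (Bimodule.tensorHomAdj ((Bimodule.regular A).restrict (RingHom.id A) f)).ofNatIsoRight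
    (homResIso f).symm

/-! ### Restriction and induction as tensor functors. -/

namespace Bimodule

variable {A B R S C : Type u} [Ring A] [Ring B] [Ring R] [Ring S] [Ring C]

/-- Restriction of an isomorphism of bimodules. -/
def Iso.restrict (f : B →+* A) (g : S →+* R) {P Q : Bimodule A R} (e : Iso P Q) :
    Iso (P.restrict f g) (Q.restrict f g) where
  toAddEquiv := e.toAddEquiv
  map_smul b := e.map_smul (f b)
  map_op_smul s := e.map_op_smul (g s)

/-- The tensor product of isomorphisms of bimodules. -/
noncomputable def Iso.tensor {P P' : Bimodule A R} {Q Q' : Bimodule R C} (e : Iso P P')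
    (e' : Iso Q Q') : Iso (P.tensor Q) (P'.tensor Q') :=
  -- Compose the two isomorphisms horizontally as functors, then read the result off on the regular
  -- module.
  isoOfTensorFunctorIso ((tensorFunctorTensor P Q).symm ≪≫
    NatIso.hcomp e'.tensorFunctorIso e.tensorFunctorIso ≪≫ tensorFunctorTensor P' Q')

/-- The isomorphism `P ⊗_R R_S ≅ P_S`. -/
noncomputable def tensorRegularRestrict (g : S →+* R) (P : Bimodule A R) :
    Iso (P.tensor ((regular R).restrict (RingHom.id R) g)) (P.restrict (RingHom.id A) g) where
  toAddEquiv := BalTensor.rid R P.carrier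
  map_smul := P.ofTensorFunctor.map_smul
  map_op_smul s := P.ofTensorFunctor.map_op_smul (g s)

/-- Induction followed by `P ⊗_R -` is `P_S ⊗_S -`. -/
noncomputable def indTensor (g : S →+* R) (P : Bimodule A R) :
    Ind g ⋙ P.tensorFunctor ≅ (P.restrict (RingHom.id A) g).tensorFunctor :=
  tensorFunctorTensor P _ ≪≫ (tensorRegularRestrict g P).tensorFunctorIso

/-- `P ⊗_R -` followed by restriction is `_B P ⊗_R -`. -/
noncomputable def tensorRes (f : B →+* A) (P : Bimodule A R) :
    P.tensorFunctor ⋙ Res f ≅ (P.restrict f (RingHom.id R)).tensorFunctor :=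
  -- Here restriction is used as a left adjoint, with coinduction as its right adjoint.
  functorIsoTensor (P.tensorHomAdj.comp (ModuleCat.restrictCoextendScalarsAdj f))
    { toAddEquiv := P.ofTensorFunctor.toAddEquiv
      map_smul := fun b => P.ofTensorFunctor.map_smul (f b)
      map_op_smul := P.ofTensorFunctor.map_op_smul }

/-- Restriction is `_S R ⊗_R -`. -/
noncomputable def resIso (g : S →+* R) :
    Res g ≅ ((regular R).restrict g (RingHom.id R)).tensorFunctor :=
  functorIsoTensor (ModuleCat.restrictCoextendScalarsAdj g)
    { toAddEquiv := AddEquiv.refl R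
      map_smul := fun _ _ => rfl
      map_op_smul := fun _ _ => rfl }

/-- Restriction followed by `Q ⊗_S -` is `(Q ⊗_S R) ⊗_R -`. -/
noncomputable def resTensor (g : S →+* R) (Q : Bimodule B S) :
    Res g ⋙ Q.tensorFunctor ≅
      (Q.tensor ((regular R).restrict g (RingHom.id R))).tensorFunctor :=
  Functor.isoWhiskerRight (resIso g) _ ≪≫ tensorFunctorTensor _ _

/-! ### Morita bimodules and equivalences -/

/-- The equivalence `P ⊗_R -` of an invertible bimodule. -/
noncomputable def equivOfInverse {P : Bimodule A R} {P' : Bimodule R A}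
    (e : Iso (P.tensor P') (regular A)) (e' : Iso (P'.tensor P) (regular R)) :
    ModuleCat.{u} R ≌ ModuleCat.{u} A :=
  -- `e` and `e'` need not be compatible: `Equivalence.mk` adjusts the unit so that the triangle
  -- identity holds.
  CategoryTheory.Equivalence.mk P.tensorFunctor P'.tensorFunctor
    (tensorFunctorRegular R ≪≫ e'.symm.tensorFunctorIso ≪≫ (tensorFunctorTensor P' P).symm)
    (tensorFunctorTensor P P' ≪≫ e.tensorFunctorIso ≪≫ (tensorFunctorRegular A).symm)

/-- An equivalence and its inverse are left adjoint to each other, so Eilenberg-Watts applies to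
both; unit and counit then become the two isomorphisms of invertibility. -/
theorem isMorita_ofFunctor (𝓕 : ModuleCat.{u} R ≌ ModuleCat.{u} A) [𝓕.functor.Additive] :
    (ofFunctor 𝓕.functor).IsMorita :=
  have : 𝓕.symm.functor.Additive := 𝓕.inverse_additive
  letI i := eilenbergWatts 𝓕.toAdjunction
  letI j := eilenbergWatts 𝓕.symm.toAdjunction
  ⟨ofFunctor 𝓕.inverse,
    ⟨isoOfTensorFunctorIso ((tensorFunctorTensor _ _).symm ≪≫ NatIso.hcomp j.symm i.symm ≪≫
      𝓕.counitIso ≪≫ tensorFunctorRegular A)⟩,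
    ⟨isoOfTensorFunctorIso ((tensorFunctorTensor _ _).symm ≪≫ NatIso.hcomp i.symm j.symm ≪≫
      𝓕.unitIso.symm ≪≫ tensorFunctorRegular R)⟩⟩

theorem exists_isMorita (𝓕 : ModuleCat.{u} R ≌ ModuleCat.{u} A) (h : 𝓕.functor.Additive) :
    ∃ P : Bimodule A R, P.IsMorita ∧ Nonempty (𝓕.functor ≅ P.tensorFunctor) :=
  ⟨ofFunctor 𝓕.functor, isMorita_ofFunctor 𝓕, ⟨eilenbergWatts 𝓕.toAdjunction⟩⟩

theorem IsMorita.exists_equivalence {P : Bimodule A R} (h : P.IsMorita) :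
    ∃ 𝓕 : ModuleCat.{u} R ≌ ModuleCat.{u} A,
      𝓕.functor.Additive ∧ Nonempty (𝓕.functor ≅ P.tensorFunctor) := by
  obtain ⟨P', ⟨e⟩, ⟨e'⟩⟩ := h
  exact ⟨equivOfInverse e e', inferInstanceAs P.tensorFunctor.Additive,
    ⟨CategoryTheory.Iso.refl _⟩⟩

theorem IsMorita.of_iso {P Q : Bimodule A R} (h : P.IsMorita) (i : Iso P Q) : Q.IsMorita := by
  obtain ⟨P', ⟨e⟩, ⟨e'⟩⟩ := h
  exact ⟨P', ⟨(i.symm.tensor (Iso.refl _)).trans e⟩, ⟨((Iso.refl _).tensor i.symm).trans e'⟩⟩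

/-! ### Opposite bimodules -/

/-- An `A`-`R`-bimodule as an `Rᵐᵒᵖ`-`Aᵐᵒᵖ`-bimodule. -/
def opp (P : Bimodule A R) : Bimodule Rᵐᵒᵖ Aᵐᵒᵖ :=
  letI : Module Aᵐᵒᵖᵐᵒᵖ P.carrier := Module.compHom P.carrier (RingEquiv.opOp A).symm.toRingHom
  { carrier := P.carrier
    smulComm := ⟨fun r a x => (smul_comm (unop (unop a)) r x).symm⟩ }

/-- An `Rᵐᵒᵖ`-`Aᵐᵒᵖ`-bimodule as an `A`-`R`-bimodule. -/
def unopp (P : Bimodule Rᵐᵒᵖ Aᵐᵒᵖ) : Bimodule A R :=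
  letI : Module A P.carrier := Module.compHom P.carrier (RingEquiv.opOp A).toRingHom
  { carrier := P.carrier
    smulComm := ⟨fun a r x => (smul_comm r (op (op a)) x).symm⟩ }

/-- The opposite of an isomorphism. -/
def Iso.opp {P Q : Bimodule A R} (e : Iso P Q) : Iso P.opp Q.opp where
  toAddEquiv := e.toAddEquiv
  map_smul r := e.map_op_smul (unop r)
  map_op_smul a := e.map_smul (unop a)

/-- The opposite of an isomorphism. -/
def Iso.unopp {P Q : Bimodule Rᵐᵒᵖ Aᵐᵒᵖ} (e : Iso P Q) : Iso P.unopp Q.unopp where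
  toAddEquiv := e.toAddEquiv
  map_smul a := e.map_op_smul (op a)
  map_op_smul r := e.map_smul (op r)

/-- The isomorphism `A ≅ Aᵐᵒᵖ` of `Aᵐᵒᵖ`-bimodules. -/
def oppRegular (A : Type u) [Ring A] : Iso (regular A).opp (regular Aᵐᵒᵖ) where
  toAddEquiv := opAddEquiv
  map_smul _ _ := rfl
  map_op_smul _ _ := rfl

/-- The isomorphism `Aᵐᵒᵖ ≅ A` of `A`-bimodules. -/
def unoppRegular (A : Type u) [Ring A] : Iso (regular Aᵐᵒᵖ).unopp (regular A) where
  toAddEquiv := opAddEquiv.symm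
  map_smul _ _ := rfl
  map_op_smul _ _ := rfl

/-- The opposite of a tensor product. -/
noncomputable def oppTensor (P : Bimodule A R) (Q : Bimodule R C) :
    Iso (P.tensor Q).opp (Q.opp.tensor P.opp) :=
  letI : Module Rᵐᵒᵖᵐᵒᵖ Q.carrier := Module.compHom Q.carrier (RingEquiv.opOp R).symm.toRingHom
  -- Both sides impose the same balancing relations, with the factors exchanged.
  letI e : BalTensor R P.carrier Q.carrier ≃+ BalTensor Rᵐᵒᵖ Q.carrier P.carrier :=
    BalTensor.flipEquiv (fun p r q => (BalTensor.smul_tmul q (op r) p).symm)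
      fun q r p => (BalTensor.smul_tmul p (unop r) q).symm
  { toAddEquiv := e
    map_smul := fun c x => BalTensor.hom_congr
      (φ := e.toAddMonoidHom.comp (DistribSMul.toAddMonoidHom (P.tensor Q).opp.carrier c))
      (ψ := (DistribSMul.toAddMonoidHom (Q.opp.tensor P.opp).carrier c).comp e.toAddMonoidHom)
      (fun _ _ => rfl) x
    map_op_smul := fun a x => BalTensor.hom_congr
      (φ := e.toAddMonoidHom.comp (DistribSMul.toAddMonoidHom (P.tensor Q).opp.carrier (op a)))
      (ψ := (DistribSMul.toAddMonoidHom (Q.opp.tensor P.opp).carrier (op a)).comp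
        e.toAddMonoidHom) (fun _ _ => rfl) x }

/-- The opposite of a tensor product. -/
noncomputable def unoppTensor (P : Bimodule Cᵐᵒᵖ Rᵐᵒᵖ) (Q : Bimodule Rᵐᵒᵖ Aᵐᵒᵖ) :
    Iso (P.tensor Q).unopp (Q.unopp.tensor P.unopp) :=
  letI : Module R P.carrier := Module.compHom P.carrier (RingEquiv.opOp R).toRingHom
  letI e : BalTensor Rᵐᵒᵖ P.carrier Q.carrier ≃+ BalTensor R Q.carrier P.carrier :=
    BalTensor.flipEquiv (fun p r q => (BalTensor.smul_tmul q (unop r) p).symm)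
      fun q r p => (BalTensor.smul_tmul p (op r) q).symm
  { toAddEquiv := e
    map_smul := fun a x => BalTensor.hom_congr
      (φ := e.toAddMonoidHom.comp (DistribSMul.toAddMonoidHom (P.tensor Q).unopp.carrier a))
      (ψ := (DistribSMul.toAddMonoidHom (Q.unopp.tensor P.unopp).carrier a).comp
        e.toAddMonoidHom) (fun _ _ => rfl) x
    map_op_smul := fun c x => BalTensor.hom_congr
      (φ := e.toAddMonoidHom.comp (DistribSMul.toAddMonoidHom (P.tensor Q).unopp.carrier (op c)))
      (ψ := (DistribSMul.toAddMonoidHom (Q.unopp.tensor P.unopp).carrier (op c)).comp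
        e.toAddMonoidHom) (fun _ _ => rfl) x }

theorem IsMorita.opp {P : Bimodule A R} (h : P.IsMorita) : P.opp.IsMorita := by
  obtain ⟨P', ⟨e⟩, ⟨e'⟩⟩ := h
  exact ⟨P'.opp, ⟨(oppTensor P' P).symm.trans (e'.opp.trans (oppRegular R))⟩,
    ⟨(oppTensor P P').symm.trans (e.opp.trans (oppRegular A))⟩⟩

theorem IsMorita.unopp {P : Bimodule Rᵐᵒᵖ Aᵐᵒᵖ} (h : P.IsMorita) : P.unopp.IsMorita := by
  obtain ⟨P', ⟨e⟩, ⟨e'⟩⟩ := h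
  exact ⟨P'.unopp, ⟨(unoppTensor P' P).symm.trans (e'.unopp.trans (unoppRegular A))⟩,
    ⟨(unoppTensor P P').symm.trans (e.unopp.trans (unoppRegular R))⟩⟩

/-! ### Duals of invertible bimodules -/

/-- The isomorphism `R ≅ Rᵐᵒᵖ` of left `Rᵐᵒᵖ`-modules. -/
def opRegularEquiv (R : Type u) [Ring R] : R ≃ₗ[Rᵐᵒᵖ] Rᵐᵒᵖ :=
  { opAddEquiv with map_smul' := fun _ _ => rfl }

/-- The dual of `P` in terms of left modules over `Aᵐᵒᵖ` and `Rᵐᵒᵖ`. -/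
def dualIso (P : Bimodule A R) : Iso P.dual (ofFunctor P.opp.homFunctor).unopp where
  -- Right `R`-linear maps `P → R` are left `Rᵐᵒᵖ`-linear maps `P → Rᵐᵒᵖ`, the value of `Hom(P, -)`
  -- at the regular module.
  toAddEquiv := ((LinearEquiv.refl Rᵐᵒᵖ P.carrier).arrowCongrAddEquiv (opRegularEquiv R))
  map_smul _ _ := rfl
  map_op_smul _ _ := rfl

/-- The inverse of an invertible bimodule is its dual. -/
noncomputable def dualIsoInverse {P : Bimodule A R} {P' : Bimodule R A}
    (e : Iso (P.tensor P') (regular A)) (e' : Iso (P'.tensor P) (regular R)) :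
    Iso P.dual P' :=
  letI 𝓔 := equivOfInverse (P := P.opp) (P' := P'.opp)
    ((oppTensor P' P).symm.trans (e'.opp.trans (oppRegular R)))
    ((oppTensor P P').symm.trans (e.opp.trans (oppRegular A)))
  -- Both functors are right adjoint to the equivalence given by tensoring with `P.opp`: one by
  -- tensor-hom, the other as its inverse.
  letI i : P.opp.homFunctor ≅ P'.opp.tensorFunctor :=
    P.opp.tensorHomAdj.rightAdjointUniq 𝓔.toAdjunction
  letI j : Iso P'.opp.unopp P' := ⟨AddEquiv.refl _, fun _ _ => rfl, fun _ _ => rfl⟩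
  (dualIso P).trans (((isoOfFunctorIso i).trans (ofTensorFunctor P'.opp)).unopp.trans j)

theorem IsMorita.dual {P : Bimodule A R} (h : P.IsMorita) : P.dual.IsMorita := by
  obtain ⟨P', ⟨e⟩, ⟨e'⟩⟩ := h
  exact IsMorita.of_iso ⟨P, ⟨e'⟩, ⟨e⟩⟩ (dualIsoInverse e e').symm

/-- The inverse `P'` has inverse `P`, and inverses are duals. This allows replacing arbitrary Morita
bimodules by duals. -/
theorem IsMorita.exists_dual {P : Bimodule A R} (h : P.IsMorita) :
    ∃ P' : Bimodule R A, P'.IsMorita ∧ Nonempty (Iso P'.dual P) := by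
  obtain ⟨P', ⟨e⟩, ⟨e'⟩⟩ := h
  exact ⟨P', ⟨P, ⟨e'⟩, ⟨e⟩⟩, ⟨dualIsoInverse e' e⟩⟩

end Bimodule

/-! ### The equivalence of the conditions -/

section Conditions

open Bimodule

variable {A B R S : Type u} [Ring A] [Ring B] [Ring R] [Ring S] (f : B →+* A) (g : S →+* R)

theorem MoritaEquivalent.symm {f : B →+* A} {g : S →+* R} :
    MoritaEquivalent f g → MoritaEquivalent g f := by
  rintro ⟨𝓕, 𝓖, _, _, ⟨e⟩⟩
  refine ⟨𝓕.symm, 𝓖.symm, 𝓕.inverse_additive, 𝓖.inverse_additive, ⟨?_⟩⟩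
  -- Insert `𝓕⁻¹ 𝓕` in front, move restriction across by `e`, and cancel `𝓖 𝓖⁻¹` at the end.
  exact (Functor.leftUnitor _).symm ≪≫
    Functor.isoWhiskerRight 𝓕.counitIso.symm (Res f ⋙ 𝓖.inverse) ≪≫
    Functor.isoWhiskerLeft 𝓕.inverse (Functor.isoWhiskerRight e.symm 𝓖.inverse) ≪≫
    Functor.isoWhiskerLeft (𝓕.inverse ⋙ Res g) 𝓖.unitIso.symm ≪≫ Functor.rightUnitor _

theorem moritaEquivalent_comm : MoritaEquivalent f g ↔ MoritaEquivalent g f :=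
  ⟨MoritaEquivalent.symm, MoritaEquivalent.symm⟩

/-- Adjoints of isomorphic functors are isomorphic. Passing to left adjoints inverts the
equivalences, which is why the extensions change places. -/
theorem moritaEquivalent_iff_commutesInd : MoritaEquivalent f g ↔ CommutesInd g f := by
  constructor
  · rintro ⟨𝓕, 𝓖, _, _, ⟨e⟩⟩
    exact ⟨𝓕.symm, 𝓖.symm, 𝓕.inverse_additive, 𝓖.inverse_additive,
      ⟨(((indResAdj f).comp 𝓕.symm.toAdjunction).ofNatIsoRight e.symm).leftAdjointUniq
        (𝓖.symm.toAdjunction.comp (indResAdj g))⟩⟩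
  · rintro ⟨𝓕, 𝓖, _, _, ⟨e⟩⟩
    exact ⟨𝓕.symm, 𝓖.symm, 𝓕.inverse_additive, 𝓖.inverse_additive,
      ⟨((𝓖.toAdjunction.comp (indResAdj g)).ofNatIsoLeft e.symm).rightAdjointUniq
        ((indResAdj f).comp 𝓕.toAdjunction)⟩⟩

/-- The same exchange, now with the right adjoints of the two composites. -/
theorem moritaEquivalent_iff_commutesCoind : MoritaEquivalent f g ↔ CommutesCoind g f := by
  constructor
  · rintro ⟨𝓕, 𝓖, _, _, ⟨e⟩⟩
    exact ⟨𝓕.symm, 𝓖.symm, 𝓕.inverse_additive, 𝓖.inverse_additive,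
      ⟨((𝓕.toAdjunction.comp (ModuleCat.restrictCoextendScalarsAdj f)).ofNatIsoLeft
        e.symm).rightAdjointUniq
          ((ModuleCat.restrictCoextendScalarsAdj g).comp 𝓖.toAdjunction)⟩⟩
  · rintro ⟨𝓕, 𝓖, _, _, ⟨e⟩⟩
    exact ⟨𝓕.symm, 𝓖.symm, 𝓕.inverse_additive, 𝓖.inverse_additive,
      ⟨(((ModuleCat.restrictCoextendScalarsAdj g).comp 𝓖.symm.toAdjunction).ofNatIsoRight
        e.symm).leftAdjointUniq
          (𝓕.symm.toAdjunction.comp (ModuleCat.restrictCoextendScalarsAdj f))⟩⟩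

theorem moritaEquivalent_iff_bimoduleQR : MoritaEquivalent f g ↔ BimoduleQR f g := by
  constructor
  · rintro ⟨𝓕, 𝓖, h𝓕, h𝓖, ⟨e⟩⟩
    obtain ⟨P, hP, ⟨i⟩⟩ := exists_isMorita 𝓕 h𝓕
    obtain ⟨Q, hQ, ⟨j⟩⟩ := exists_isMorita 𝓖 h𝓖
    exact ⟨P, Q, hP, hQ, ⟨isoOfTensorFunctorIso ((resTensor g Q).symm ≪≫
      Functor.isoWhiskerLeft (Res g) j.symm ≪≫ e ≪≫ Functor.isoWhiskerRight i (Res f) ≪≫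
        tensorRes f P)⟩⟩
  · rintro ⟨P, Q, hP, hQ, ⟨e⟩⟩
    obtain ⟨𝓕, h𝓕, ⟨i⟩⟩ := hP.exists_equivalence
    obtain ⟨𝓖, h𝓖, ⟨j⟩⟩ := hQ.exists_equivalence
    exact ⟨𝓕, 𝓖, h𝓕, h𝓖, ⟨Functor.isoWhiskerLeft (Res g) j ≪≫ resTensor g Q ≪≫
      e.tensorFunctorIso ≪≫ (tensorRes f P).symm ≪≫ Functor.isoWhiskerRight i.symm (Res f)⟩⟩

theorem commutesInd_iff_bimoduleAQ : CommutesInd f g ↔ BimoduleAQ f g := by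
  constructor
  · rintro ⟨𝓕, 𝓖, h𝓕, h𝓖, ⟨e⟩⟩
    obtain ⟨P, hP, ⟨i⟩⟩ := exists_isMorita 𝓕 h𝓕
    obtain ⟨Q, hQ, ⟨j⟩⟩ := exists_isMorita 𝓖 h𝓖
    exact ⟨P, Q, hP, hQ, ⟨isoOfTensorFunctorIso ((tensorFunctorTensor _ Q).symm ≪≫
      Functor.isoWhiskerRight j.symm (Ind f) ≪≫ e.symm ≪≫ Functor.isoWhiskerLeft (Ind g) i ≪≫
        indTensor g P)⟩⟩
  · rintro ⟨P, Q, hP, hQ, ⟨e⟩⟩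
    obtain ⟨𝓕, h𝓕, ⟨i⟩⟩ := hP.exists_equivalence
    obtain ⟨𝓖, h𝓖, ⟨j⟩⟩ := hQ.exists_equivalence
    exact ⟨𝓕, 𝓖, h𝓕, h𝓖, ⟨Functor.isoWhiskerLeft (Ind g) i ≪≫ indTensor g P ≪≫
      e.symm.tensorFunctorIso ≪≫ (tensorFunctorTensor _ Q).symm ≪≫
        Functor.isoWhiskerRight j.symm (Ind f)⟩⟩

theorem bimoduleRQdual_iff : BimoduleRQdual f g ↔ BimoduleAQ g f := by
  constructor
  · rintro ⟨P, Q, hP, hQ, e⟩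
    -- The isomorphism `e` is already the required one for the dual bimodules.
    exact ⟨P.dual, Q.dual, hP.dual, hQ.dual, e⟩
  · rintro ⟨P, Q, hP, hQ, ⟨e⟩⟩
    obtain ⟨P', hP', ⟨i⟩⟩ := hP.exists_dual
    obtain ⟨Q', hQ', ⟨j⟩⟩ := hQ.exists_dual
    exact ⟨P', Q', hP', hQ',
      ⟨((Bimodule.Iso.refl _).tensor j).trans (e.trans (i.symm.restrict _ _))⟩⟩

theorem bimoduleQdualA_iff : BimoduleQdualA f g ↔ BimoduleQR g f := by
  constructor
  · rintro ⟨P, Q, hP, hQ, e⟩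
    exact ⟨P.dual, Q.dual, hP.dual, hQ.dual, e⟩
  · rintro ⟨P, Q, hP, hQ, ⟨e⟩⟩
    obtain ⟨P', hP', ⟨i⟩⟩ := hP.exists_dual
    obtain ⟨Q', hQ', ⟨j⟩⟩ := hQ.exists_dual
    exact ⟨P', Q', hP', hQ',
      ⟨(j.tensor (Bimodule.Iso.refl _)).trans (e.trans (i.symm.restrict _ _))⟩⟩

/-- Taking opposites reverses the tensor product, moving the regular bimodule from the right factor
to the left, and swaps the two sides of `P` and `Q`, hence the extensions. -/
theorem bimoduleQR_op_iff : BimoduleQR (RingHom.op f) (RingHom.op g) ↔ BimoduleAQ g f := by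
  constructor
  · rintro ⟨P, Q, hP, hQ, ⟨e⟩⟩
    let i : Iso ((regular R).restrict (RingHom.id R) g)
        ((regular Rᵐᵒᵖ).restrict (RingHom.op g) (RingHom.id Rᵐᵒᵖ)).unopp :=
      ⟨opAddEquiv, fun _ _ => rfl, fun _ _ => rfl⟩
    let j : Iso (P.restrict (RingHom.op f) (RingHom.id Rᵐᵒᵖ)).unopp
        (P.unopp.restrict (RingHom.id R) f) :=
      ⟨AddEquiv.refl _, fun _ _ => rfl, fun _ _ => rfl⟩
    exact ⟨P.unopp, Q.unopp, hP.unopp, hQ.unopp,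
      ⟨(i.tensor (Bimodule.Iso.refl _)).trans ((unoppTensor Q _).symm.trans (e.unopp.trans j))⟩⟩
  · rintro ⟨P, Q, hP, hQ, ⟨e⟩⟩
    let i : Iso ((regular Rᵐᵒᵖ).restrict (RingHom.op g) (RingHom.id Rᵐᵒᵖ))
        ((regular R).restrict (RingHom.id R) g).opp :=
      ⟨opAddEquiv.symm, fun _ _ => rfl, fun _ _ => rfl⟩
    let j : Iso (P.restrict (RingHom.id R) f).opp
        (P.opp.restrict (RingHom.op f) (RingHom.id Rᵐᵒᵖ)) :=
      ⟨AddEquiv.refl _, fun _ _ => rfl, fun _ _ => rfl⟩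
    exact ⟨P.opp, Q.opp, hP.opp, hQ.opp,
      ⟨((Bimodule.Iso.refl _).tensor i).trans ((oppTensor _ Q).symm.trans (e.opp.trans j))⟩⟩

theorem commutesInd_iff : CommutesInd f g ↔ MoritaEquivalent f g :=
  (moritaEquivalent_iff_commutesInd g f).symm.trans (moritaEquivalent_comm g f)

theorem commutesCoind_iff : CommutesCoind f g ↔ MoritaEquivalent f g :=
  (moritaEquivalent_iff_commutesCoind g f).symm.trans (moritaEquivalent_comm g f)

theorem bimoduleQR_iff : BimoduleQR f g ↔ MoritaEquivalent f g :=
  (moritaEquivalent_iff_bimoduleQR f g).symm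

theorem bimoduleAQ_iff : BimoduleAQ f g ↔ MoritaEquivalent f g :=
  (commutesInd_iff_bimoduleAQ f g).symm.trans (commutesInd_iff f g)

theorem moritaEquivalent_op_iff :
    MoritaEquivalent (RingHom.op f) (RingHom.op g) ↔ MoritaEquivalent f g := by
  rw [← bimoduleQR_iff, bimoduleQR_op_iff, bimoduleAQ_iff, moritaEquivalent_comm]

end Conditions

end MoritaExt

theorem mainTheorem7 {A B R S : Type u} [Ring A] [Ring B] [Ring R] [Ring S]
    (f : B →+* A) (g : S →+* R) :
    List.TFAE [
      MoritaExt.MoritaEquivalent f g,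
      MoritaExt.BimoduleQR f g,
      MoritaExt.BimoduleRQdual f g,
      MoritaExt.BimoduleAQ f g,
      MoritaExt.BimoduleQdualA f g,
      MoritaExt.CommutesInd f g,
      MoritaExt.CommutesCoind f g,
      MoritaExt.MoritaEquivalent (RingHom.op f) (RingHom.op g),
      MoritaExt.BimoduleQR (RingHom.op f) (RingHom.op g),
      MoritaExt.BimoduleRQdual (RingHom.op f) (RingHom.op g),
      MoritaExt.BimoduleAQ (RingHom.op f) (RingHom.op g),
      MoritaExt.BimoduleQdualA (RingHom.op f) (RingHom.op g),
      MoritaExt.CommutesInd (RingHom.op f) (RingHom.op g),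
      MoritaExt.CommutesCoind (RingHom.op f) (RingHom.op g)] := by
  -- Every entry normalises to `MoritaEquivalent f g`; symmetry is instantiated at `g f`, so it
  -- rewrites in one direction only.
  simp only [MoritaExt.bimoduleRQdual_iff, MoritaExt.bimoduleQdualA_iff,
    MoritaExt.bimoduleQR_iff, MoritaExt.bimoduleAQ_iff, MoritaExt.commutesInd_iff,
    MoritaExt.commutesCoind_iff, MoritaExt.moritaEquivalent_op_iff,
    MoritaExt.moritaEquivalent_comm g f]
  exact List.tfae_of_forall (MoritaExt.MoritaEquivalent f g) _ (by simp)
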